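/- Let $H^2$ be the Hardy space of the unit disc $\mathbb{D}$, i.e. the Hilbert space of the analytic functions $f(z)=\sum_{n\ge 0}c_nz^n$ on $\mathbb{D}$ with $\|f\|^2=\sum_{n\ge 0}|c_n|^2<\infty$. For $\mathbf{s}\subseteq\mathbb{D}$ put $\mathcal{Z}_{\mathbf{s}}=\{f\in H^2: f(z)=0 \text{ for all } z\in\mathbf{s}\}$, $\mathcal{K}_{\mathbf{s}}=\mathcal{Z}_{\mathbf{s}}^\perp$ and $\lim\mathbf{s}=\overline{\mathbf{s}}\setminus\mathbf{s}$ (closure in $\mathbb{C}$). Let $\mathbf{a}=\{a_k:k\ge 1\}$ and $\mathbf{b}=\{b_j:j\ge1\}$ be disjoint infinite subsets of $\mathbb{D}$, each enumerated without repetition, with $\sum_k(1-|a_k|)<\infty$ and $\sum_j(1-|b_j|)<\infty$. Let $B_{\mathbf{a}}(z)=\prod_{k}b_{a_k}(z)$ be the Blaschke product with zero set $\mathbf{a}$, where $b_0(z)=z$ and $b_w(z)=\frac{\bar w}{|w|}\,\frac{w-z}{1-\bar w z}$ for $w\neq 0$. Let $\mathcal{H}_0=\mathcal{K}_{\mathbf{a}\cup\mathbf{b}}$,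 $\mathcal{Z}_{\mathbf{a}}^0=\mathcal{Z}_{\mathbf{a}}\cap\mathcal{H}_0$ and $\mathcal{Z}_{\mathbf{b}}^0=\mathcal{Z}_{\mathbf{b}}\cap\mathcal{H}_0$, and write $P_{\mathcal{S}}$ for the orthogonal projection of $H^2$ onto a closed subspace $\mathcal{S}$. If $P_{\mathcal{K}_{\mathbf{b}}}P_{\mathcal{Z}_{\mathbf{a}}^0}$ is compact, then 1. $B_{\mathbf{a}}(b_j)\to 0$ as $j\to\infty$; 2. $\lim\mathbf{b}\subseteq\lim\mathbf{a}$. Consequently, if both $P_{\mathcal{K}_{\mathbf{b}}}P_{\mathcal{Z}_{\mathbf{a}}^0}$ and $P_{\mathcal{K}_{\mathbf{a}}}P_{\mathcal{Z}_{\mathbf{b}}^0}$ are compact, then $\lim\mathbf{a}=\lim\mathbf{b}$. -/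

import Mathlib

open Filter Topology Complex

/-- The Hardy space `H²` of the unit disc: the functions `f(z) = ∑ cₙ zⁿ` on the disc with
square-summable Taylor coefficients, `‖f‖² = ∑ |cₙ|²`, a function being represented by its
sequence `(cₙ)` of coefficients. (Equivalently, the holomorphic functions on the disc whose
integral means `(1 / 2π) ∫ |f(r eⁱᵗ)|² dt` are bounded for `0 < r < 1`; the supremum of these
means is `‖f‖²`.) -/
abbrev HardySpace : Type := lp (fun _ : ℕ => ℂ) 2

namespace HardySpace

/-- The value at `z` of the function `f`. -/
noncomputable def eval (f : HardySpace) (z : UnitDisc) : ℂ :=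
  ∑' n : ℕ, f n * (z : ℂ) ^ n

/-- The Szegő kernel `k_w(z) = 1 / (1 - conj w * z) = ∑ (conj w)ⁿ zⁿ`. -/
noncomputable def szego (w : UnitDisc) : HardySpace :=
  ⟨fun n => (starRingEnd ℂ (w : ℂ)) ^ n, by
    refine memℓp_gen ?_
    have h : ‖(w : ℂ)‖ ^ 2 < 1 := by
      have := w.norm_lt_one
      have h0 := norm_nonneg (w : ℂ)
      nlinarith
    have := summable_geometric_of_lt_one (by positivity) h
    refine this.congr fun n => ?_
    simp [← pow_mul, mul_comm]⟩

theorem inner_szego (f : HardySpace) (z : UnitDisc) : inner ℂ (szego z) f = f.eval z := by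
  rw [lp.inner_eq_tsum]
  simp [eval, szego]

/-- The subspace `Z_s` of the functions in `H²` that vanish at every point of `s`. -/
noncomputable def zeroSpace (s : Set UnitDisc) : Submodule ℂ HardySpace where
  carrier := {f | ∀ z ∈ s, f.eval z = 0}
  add_mem' := by
    intro f g hf hg z hz
    have h1 := hf z hz
    have h2 := hg z hz
    rw [← inner_szego] at h1 h2 ⊢
    rw [inner_add_right, h1, h2, add_zero]
  zero_mem' := by
    intro z _
    rw [← inner_szego, inner_zero_right]
  smul_mem' := by
    intro c f hf z hz
    have h1 := hf z hz
    rw [← inner_szego] at h1 ⊢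
    rw [inner_smul_right, h1, mul_zero]

theorem isClosed_zeroSpace (s : Set UnitDisc) : IsClosed (zeroSpace s : Set HardySpace) := by
  have h : (zeroSpace s : Set HardySpace) = ⋂ z ∈ s, {f | inner ℂ (szego z) f = 0} := by
    ext f
    simp [zeroSpace, inner_szego]
  rw [h]
  exact isClosed_biInter fun z _ => isClosed_eq (by fun_prop) continuous_const

/-- The model space `K_s = Z_sᗮ`. -/
noncomputable def modelSpace (s : Set UnitDisc) : Submodule ℂ HardySpace :=
  (zeroSpace s)ᗮ

/-- With `H₀ = K_{s ∪ t}`, the subspace `Z_s⁰ = Z_s ∩ H₀` (that is, `H₀ ⊖ K_s`). -/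
noncomputable def zeroSpace₀ (s t : Set UnitDisc) : Submodule ℂ HardySpace :=
  zeroSpace s ⊓ modelSpace (s ∪ t)

instance (s : Set UnitDisc) : CompleteSpace (modelSpace s) :=
  inferInstanceAs (CompleteSpace ((zeroSpace s)ᗮ : Submodule ℂ HardySpace))

instance (s t : Set UnitDisc) : CompleteSpace (zeroSpace₀ s t) :=
  ((isClosed_zeroSpace s).inter
    (Submodule.isClosed_orthogonal (zeroSpace (s ∪ t)))).completeSpace_coe

/-- The operator `P_{K_t} P_{Z_s⁰}` on `H²`, a product of two orthogonal projections. -/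
noncomputable def projProd (s t : Set UnitDisc) : HardySpace →L[ℂ] HardySpace :=
  (modelSpace t).starProjection ∘L (zeroSpace₀ s t).starProjection

end HardySpace

/-- The Blaschke factor with zero `w`. -/
noncomputable def blaschkeFactor (w z : UnitDisc) : ℂ :=
  open Classical in
  if (w : ℂ) = 0 then (z : ℂ)
  else starRingEnd ℂ (w : ℂ) / (‖(w : ℂ)‖ : ℂ) *
    (((w : ℂ) - z) / (1 - starRingEnd ℂ (w : ℂ) * z))

/-- The Blaschke product `B_a` with the zeros `a 0, a 1, …`. -/
noncomputable def blaschkeProduct (a : ℕ → UnitDisc) (z : UnitDisc) : ℂ :=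
  ∏' k, blaschkeFactor (a k) z

/-- The limit set `lim s = closure s \ s`, the closure being taken in the plane. -/
def limitSet (s : Set UnitDisc) : Set ℂ :=
  closure ((fun z : UnitDisc => (z : ℂ)) '' s) \ ((fun z : UnitDisc => (z : ℂ)) '' s)

/-! Let `x j` be the normalized Szegő kernel at `b j`, and `u j` its projection to the zero space of
`a` inside `H₀`. Since `x j` lies in `K_b`, pairing it with the compact operator applied to `u j`
gives `‖u j‖ ^ 2`. The kernels are weakly null because `|b j| → 1`, so `u j → 0`
(`IsCompactOperator.tendsto_inner_zero`). Moreover `u j = x j - P_{K_a} x j`, so `‖u j‖` is the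
distance from `x j` to `K_a`. Pairing with finite Blaschke multiples of `x j` bounds that distance
below by `|B_a(b j)|` (`norm_blaschkeProduct_le_norm_sub`), which gives the first claim.

For the second, a point `p` of `lim b` is unimodular. If it were away from the closure of `a`, then
`1 - |B_a(z)|² ≤ C (1 - |z|²)` near `p` (`le_norm_blaschkeProduct_sq`), so `|B_a(b j)|` would be
close to 1 for infinitely many `j`. -/

namespace HardySpace

/-! ### Multiplication by the variable on `H²` -/

theorem eval_smul (c : ℂ) (f : HardySpace) (z : UnitDisc) : (c • f).eval z = c * f.eval z := by
  simp only [← inner_szego, inner_smul_right]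

theorem eval_sub (f g : HardySpace) (z : UnitDisc) : (f - g).eval z = f.eval z - g.eval z := by
  simp only [← inner_szego, inner_sub_right]

theorem summable_eval (f : HardySpace) (z : UnitDisc) :
    Summable fun n : ℕ => f n * (z : ℂ) ^ n := by
  simpa [szego] using lp.summable_inner (𝕜 := ℂ) (szego z) f

theorem summable_norm_sq (f : HardySpace) : Summable fun n => ‖f n‖ ^ 2 := by
  have h := (lp.memℓp f).summable (by norm_num)
  simpa using h

theorem norm_sq_eq_tsum (f : HardySpace) : ‖f‖ ^ 2 = ∑' n, ‖f n‖ ^ 2 := by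
  have h := lp.norm_rpow_eq_tsum (p := 2) (by norm_num) f
  simpa using h

/-- The coefficients of `z ↦ z * f z`. -/
def shiftSeq (f : ℕ → ℂ) : ℕ → ℂ
  | 0 => 0
  | n + 1 => f n

theorem memℓp_shiftSeq (f : HardySpace) : Memℓp (shiftSeq f) 2 := by
  refine memℓp_gen ?_
  rw [← summable_nat_add_iff 1]
  simpa [shiftSeq] using summable_norm_sq f

/-- Multiplication by the independent variable on `H²`. -/
noncomputable def shift : HardySpace →ₗᵢ[ℂ] HardySpace where
  toFun f := ⟨shiftSeq f, memℓp_shiftSeq f⟩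
  map_add' f g := by
    ext n
    change shiftSeq ⇑(f + g) n = shiftSeq f n + shiftSeq g n
    cases n <;> simp [shiftSeq]
  map_smul' c f := by
    ext n
    cases n <;> simp [shiftSeq]
  norm_map' f := by
    rw [← sq_eq_sq₀ (norm_nonneg _) (norm_nonneg _), norm_sq_eq_tsum f, norm_sq_eq_tsum,
      (summable_norm_sq _).tsum_eq_zero_add]
    simp [shiftSeq]

theorem eval_shift (f : HardySpace) (z : UnitDisc) : (shift f).eval z = z * f.eval z := by
  unfold eval
  rw [(summable_eval (shift f) z).tsum_eq_zero_add, ← tsum_mul_left]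
  simp only [shift, LinearIsometry.coe_mk, LinearMap.coe_mk, AddHom.coe_mk, shiftSeq, zero_mul,
    zero_add]
  exact tsum_congr fun n => by ring

/-- Expand both squares: the shift is isometric and the cross terms agree. This replaces the
boundary fact `|w - z| = |1 - conj w * z|` for `|z| = 1`. -/
theorem norm_smul_sub_shift (w : ℂ) (f : HardySpace) :
    ‖w • f - shift f‖ = ‖f - starRingEnd ℂ w • shift f‖ := by
  rw [← sq_eq_sq₀ (norm_nonneg _) (norm_nonneg _), @norm_sub_sq ℂ, @norm_sub_sq ℂ]
  simp only [inner_smul_left, inner_smul_right, norm_smul, LinearIsometry.norm_map, RCLike.norm_conj]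
  ring

/-- Division by `1 - conj w * z` within `H²`, by a Neumann series, as `conj w • shift` has norm
below 1. -/
theorem exists_sub_conj_smul_shift (w : UnitDisc) (f : HardySpace) :
    ∃ h : HardySpace, h - starRingEnd ℂ (w : ℂ) • shift h = f := by
  have hn : ‖starRingEnd ℂ (w : ℂ) • shift.toContinuousLinearMap‖ < 1 := by
    rw [norm_smul, RCLike.norm_conj]
    calc _ ≤ ‖(w : ℂ)‖ * 1 := by
          gcongr
          exact shift.norm_toContinuousLinearMap_le
      _ < 1 := by simpa using w.norm_lt_one
  obtain ⟨u, hu⟩ := isUnit_one_sub_of_norm_lt_one hn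
  refine ⟨(↑u⁻¹ : HardySpace →L[ℂ] HardySpace) f, ?_⟩
  have h := congrArg (fun T : HardySpace →L[ℂ] HardySpace => T f) u.mul_inv
  rw [hu] at h
  simpa using h

end HardySpace

/-! ### Blaschke factors and multiplication by them -/

theorem UnitDisc.one_sub_conj_mul_ne_zero (w z : UnitDisc) :
    1 - starRingEnd ℂ (w : ℂ) * z ≠ 0 := by
  intro h
  have h1 : ‖starRingEnd ℂ (w : ℂ) * z‖ = 1 := by rw [← sub_eq_zero.1 h, norm_one]
  rw [norm_mul, RCLike.norm_conj] at h1
  nlinarith [w.norm_lt_one, z.norm_lt_one, norm_nonneg (w : ℂ), norm_nonneg (z : ℂ)]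

theorem exists_blaschkeFactor_eq (w : UnitDisc) : ∃ c : ℂ, ‖c‖ = 1 ∧ ∀ z : UnitDisc,
    blaschkeFactor w z = c * (((w : ℂ) - z) / (1 - starRingEnd ℂ (w : ℂ) * z)) := by
  by_cases hw : (w : ℂ) = 0
  · exact ⟨-1, by simp, fun z => by simp [blaschkeFactor, hw]⟩
  · refine ⟨starRingEnd ℂ (w : ℂ) / (‖(w : ℂ)‖ : ℂ), ?_, fun z => by simp [blaschkeFactor, hw]⟩
    simp [hw]

theorem blaschkeFactor_self (w : UnitDisc) : blaschkeFactor w w = 0 := by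
  obtain ⟨c, -, h⟩ := exists_blaschkeFactor_eq w
  simp [h]

theorem norm_one_sub_conj_mul_sq (w z : ℂ) :
    ‖1 - starRingEnd ℂ w * z‖ ^ 2 = ‖w - z‖ ^ 2 + (1 - ‖w‖ ^ 2) * (1 - ‖z‖ ^ 2) := by
  simp only [← Complex.normSq_eq_norm_sq, Complex.normSq_apply, Complex.sub_re, Complex.sub_im,
    Complex.mul_re, Complex.mul_im, Complex.conj_re, Complex.conj_im, Complex.one_re,
    Complex.one_im]
  ring

theorem one_sub_norm_blaschkeFactor_sq (w z : UnitDisc) :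
    1 - ‖blaschkeFactor w z‖ ^ 2 = (1 - ‖(w : ℂ)‖ ^ 2) * (1 - ‖(z : ℂ)‖ ^ 2) /
      ‖1 - starRingEnd ℂ (w : ℂ) * z‖ ^ 2 := by
  obtain ⟨c, hc, h⟩ := exists_blaschkeFactor_eq w
  have h0 := norm_ne_zero_iff.2 (UnitDisc.one_sub_conj_mul_ne_zero w z)
  rw [h, norm_mul, hc, one_mul, norm_div, div_pow,
    eq_div_iff (pow_ne_zero 2 h0), sub_mul, div_mul_cancel₀ _ (pow_ne_zero 2 h0),
    norm_one_sub_conj_mul_sq]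
  ring

namespace HardySpace

/-- Writing `f = (1 - conj w * z) h` turns the product into `c (w - z) h`, whose norm is that of `f`
by `norm_smul_sub_shift`. -/
theorem exists_blaschkeFactor_mul (w : UnitDisc) (f : HardySpace) :
    ∃ g : HardySpace, ‖g‖ = ‖f‖ ∧ ∀ z, g.eval z = blaschkeFactor w z * f.eval z := by
  obtain ⟨c, hc, hB⟩ := exists_blaschkeFactor_eq w
  obtain ⟨h, rfl⟩ := exists_sub_conj_smul_shift w f
  refine ⟨c • ((w : ℂ) • h - shift h), ?_, fun z => ?_⟩
  · rw [norm_smul, hc, one_mul, norm_smul_sub_shift]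
  · have h0 := UnitDisc.one_sub_conj_mul_ne_zero w z
    simp only [hB, eval_smul, eval_sub, eval_shift]
    rw [mul_assoc c, div_mul_eq_mul_div, ← mul_assoc (starRingEnd ℂ (w : ℂ)), ← one_sub_mul,
      ← mul_assoc, mul_right_comm, mul_div_cancel_right₀ _ h0, sub_mul]

theorem exists_prod_blaschkeFactor_mul (a : ℕ → UnitDisc) (f : HardySpace) (N : ℕ) :
    ∃ g : HardySpace, ‖g‖ = ‖f‖ ∧
      ∀ z, g.eval z = (∏ k ∈ Finset.range N, blaschkeFactor (a k) z) * f.eval z := by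
  induction N with
  | zero => exact ⟨f, rfl, fun z => by simp⟩
  | succ N ih =>
    obtain ⟨g, hg, hgz⟩ := ih
    obtain ⟨g', hg', hgz'⟩ := exists_blaschkeFactor_mul (a N) g
    refine ⟨g', hg'.trans hg, fun z => ?_⟩
    rw [hgz', hgz, Finset.prod_range_succ]
    ring

end HardySpace

/-! ### Convergence of Blaschke products and a lower bound -/

theorem norm_one_sub_blaschkeFactor_le (w z : UnitDisc) :
    ‖1 - blaschkeFactor w z‖ ≤ 2 / (1 - ‖(z : ℂ)‖) * (1 - ‖(w : ℂ)‖) := by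
  have hz := z.norm_lt_one
  have hz0 : 0 < 1 - ‖(z : ℂ)‖ := by linarith
  by_cases hw : (w : ℂ) = 0
  · simp only [blaschkeFactor, hw, if_true, norm_zero, sub_zero, mul_one]
    calc ‖1 - (z : ℂ)‖ ≤ ‖(1 : ℂ)‖ + ‖(z : ℂ)‖ := norm_sub_le _ _
      _ ≤ 2 / 1 := by rw [norm_one]; linarith
      _ ≤ _ := by gcongr; linarith [norm_nonneg (z : ℂ)]
  · have h0 := UnitDisc.one_sub_conj_mul_ne_zero w z
    have hr : (‖(w : ℂ)‖ : ℂ) ≠ 0 := by simpa using hw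
    have hww : starRingEnd ℂ (w : ℂ) * w = (‖(w : ℂ)‖ : ℂ) ^ 2 := by
      rw [mul_comm, Complex.mul_conj, Complex.normSq_eq_norm_sq]
      push_cast
      rfl
    -- The unimodular normalization of the factor is what lets `1 - |w|` split off.
    have key : 1 - blaschkeFactor w z = ((1 - ‖(w : ℂ)‖ : ℝ) : ℂ) *
        ((1 + starRingEnd ℂ (w : ℂ) / ‖(w : ℂ)‖ * z) / (1 - starRingEnd ℂ (w : ℂ) * z)) := by
      simp only [blaschkeFactor, hw, if_false]
      push_cast
      field_simp
      linear_combination -hww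
    have hw1 : 0 ≤ 1 - ‖(w : ℂ)‖ := by linarith [w.norm_lt_one]
    rw [key, norm_mul, Complex.norm_real, Real.norm_of_nonneg hw1, mul_comm, norm_div]
    gcongr
    · calc _ ≤ ‖(1 : ℂ)‖ + ‖starRingEnd ℂ (w : ℂ) / ‖(w : ℂ)‖ * z‖ := norm_add_le _ _
        _ = 1 + ‖(z : ℂ)‖ := by simp [hw]
        _ ≤ 2 := by linarith
    · calc 1 - ‖(z : ℂ)‖ ≤ ‖(1 : ℂ)‖ - ‖starRingEnd ℂ (w : ℂ) * z‖ := by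
            rw [norm_mul, RCLike.norm_conj, norm_one]
            nlinarith [w.norm_lt_one, norm_nonneg (z : ℂ)]
        _ ≤ _ := norm_sub_norm_le _ _

theorem hasProd_blaschkeProduct (a : ℕ → UnitDisc) (haB : Summable fun k => 1 - ‖(a k : ℂ)‖)
    (z : UnitDisc) : HasProd (fun k => blaschkeFactor (a k) z) (blaschkeProduct a z) := by
  have h : Multipliable fun k => 1 + (blaschkeFactor (a k) z - 1) := by
    refine multipliable_one_add_of_summable ?_
    refine Summable.of_nonneg_of_le (fun _ => norm_nonneg _) (fun k => ?_)
      (haB.mul_left (2 / (1 - ‖(z : ℂ)‖)))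
    rw [norm_sub_rev]
    exact norm_one_sub_blaschkeFactor_le _ _
  simp only [add_sub_cancel] at h
  exact h.hasProd

/-- Weierstrass' product inequality. -/
theorem one_sub_sum_le_prod_one_sub (e : ℕ → ℝ) (h0 : ∀ k, 0 ≤ e k) (h1 : ∀ k, e k ≤ 1)
    (s : Finset ℕ) : 1 - ∑ k ∈ s, e k ≤ ∏ k ∈ s, (1 - e k) := by
  induction s using Finset.cons_induction with
  | empty => simp
  | cons i s hi ih =>
    rw [Finset.sum_cons, Finset.prod_cons]
    have hp : ∏ k ∈ s, (1 - e k) ≤ 1 :=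
      Finset.prod_le_one (fun k _ => by linarith [h1 k]) fun k _ => by linarith [h0 k]
    nlinarith [h0 i, h1 i]

/-- Each `1 - |b_{a k}(z)|²` is at most `2 (1 - |a k|)(1 - |z|²) / d²`, the 2 bounding `1 + |a k|`;
the Weierstrass inequality adds these defects up. -/
theorem le_norm_blaschkeProduct_sq (a : ℕ → UnitDisc) (haB : Summable fun k => 1 - ‖(a k : ℂ)‖)
    (z : UnitDisc) {d : ℝ} (hd : 0 < d) (h : ∀ k, d ≤ ‖1 - starRingEnd ℂ (a k : ℂ) * z‖) :
    1 - (1 - ‖(z : ℂ)‖ ^ 2) * (2 / d ^ 2 * ∑' k, (1 - ‖(a k : ℂ)‖)) ≤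
      ‖blaschkeProduct a z‖ ^ 2 := by
  have hz : 0 ≤ 1 - ‖(z : ℂ)‖ ^ 2 := by linarith [z.sq_norm_lt_one]
  have hlim := ((hasProd_blaschkeProduct a haB z).norm.tendsto_prod_nat).pow 2
  refine ge_of_tendsto' hlim fun N => ?_
  rw [← Finset.prod_pow]
  have hk : ∀ k, 1 - ‖blaschkeFactor (a k) z‖ ^ 2 ≤
      (1 - ‖(z : ℂ)‖ ^ 2) * (2 / d ^ 2) * (1 - ‖(a k : ℂ)‖) := fun k => by
    have hw : 0 ≤ 1 - ‖(a k : ℂ)‖ := by linarith [(a k).norm_lt_one]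
    rw [one_sub_norm_blaschkeFactor_sq]
    calc _ ≤ (2 * (1 - ‖(a k : ℂ)‖)) * (1 - ‖(z : ℂ)‖ ^ 2) / d ^ 2 := by
          gcongr
          · nlinarith
          · exact h k
      _ = _ := by ring
  have hW := one_sub_sum_le_prod_one_sub (fun k => 1 - ‖blaschkeFactor (a k) z‖ ^ 2)
    (fun k => by
      rw [one_sub_norm_blaschkeFactor_sq]
      exact div_nonneg (mul_nonneg (by linarith [(a k).sq_norm_lt_one]) hz) (by positivity))
    (fun k => by linarith [sq_nonneg ‖blaschkeFactor (a k) z‖]) (Finset.range N)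
  simp only [sub_sub_cancel] at hW
  refine le_trans ?_ hW
  have hs : ∑ k ∈ Finset.range N, (1 - ‖blaschkeFactor (a k) z‖ ^ 2) ≤
      (1 - ‖(z : ℂ)‖ ^ 2) * (2 / d ^ 2) * ∑' k, (1 - ‖(a k : ℂ)‖) := by
    calc _ ≤ ∑ k ∈ Finset.range N, (1 - ‖(z : ℂ)‖ ^ 2) * (2 / d ^ 2) * (1 - ‖(a k : ℂ)‖) :=
          Finset.sum_le_sum fun k _ => hk k
      _ ≤ _ := by
        rw [← Finset.mul_sum]
        gcongr
        exact haB.sum_le_tsum _ fun k _ => by linarith [(a k).norm_lt_one]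
  linarith

/-! ### Szegő kernels and model spaces -/

namespace HardySpace

theorem orthogonal_span_szego (s : Set UnitDisc) :
    (Submodule.span ℂ (szego '' s))ᗮ = zeroSpace s := by
  ext f
  rw [Submodule.mem_orthogonal]
  constructor
  · intro h z hz
    rw [← inner_szego]
    exact h _ (Submodule.subset_span ⟨z, hz, rfl⟩)
  · intro h u hu
    induction hu using Submodule.span_induction with
    | mem x hx =>
      obtain ⟨z, hz, rfl⟩ := hx
      rw [inner_szego]
      exact h z hz
    | zero => exact inner_zero_left _
    | add x y _ _ hx hy => rw [inner_add_left, hx, hy, add_zero]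
    | smul c x _ hx => rw [inner_smul_left, hx, mul_zero]

theorem modelSpace_eq_closure_span (s : Set UnitDisc) :
    modelSpace s = (Submodule.span ℂ (szego '' s)).topologicalClosure := by
  rw [modelSpace, ← orthogonal_span_szego, Submodule.orthogonal_orthogonal_eq_closure]

theorem orthogonal_modelSpace (s : Set UnitDisc) : (modelSpace s)ᗮ = zeroSpace s := by
  rw [modelSpace, ← orthogonal_span_szego, Submodule.triorthogonal_eq_orthogonal]

theorem szego_mem_modelSpace {s : Set UnitDisc} {w : UnitDisc} (hw : w ∈ s) :
    szego w ∈ modelSpace s := by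
  rw [modelSpace_eq_closure_span]
  exact Submodule.le_topologicalClosure _ (Submodule.subset_span ⟨w, hw, rfl⟩)

theorem modelSpace_mono {s t : Set UnitDisc} (h : s ⊆ t) : modelSpace s ≤ modelSpace t :=
  Submodule.orthogonal_le fun _ hf z hz => hf z (h hz)

theorem szego_eval_self (w : UnitDisc) : (szego w).eval w = ((1 - ‖(w : ℂ)‖ ^ 2)⁻¹ : ℝ) := by
  have h : ∀ n : ℕ, starRingEnd ℂ (w : ℂ) ^ n * (w : ℂ) ^ n = ((‖(w : ℂ)‖ ^ 2) ^ n : ℝ) := by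
    intro n
    rw [← mul_pow, mul_comm, Complex.mul_conj, Complex.normSq_eq_norm_sq]
    push_cast
    rfl
  simp only [eval, szego, h]
  rw [← Complex.ofReal_tsum, tsum_geometric_of_lt_one (by positivity) w.sq_norm_lt_one]

theorem norm_szego_sq (w : UnitDisc) : ‖szego w‖ ^ 2 = (1 - ‖(w : ℂ)‖ ^ 2)⁻¹ := by
  have h := inner_self_eq_norm_sq_to_K (𝕜 := ℂ) (szego w)
  rw [inner_szego, szego_eval_self] at h
  rw [← Complex.ofReal_inj, h]
  push_cast
  rfl

/-- The normalized Szegő kernel `k_w / ‖k_w‖`. -/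
noncomputable def normalizedSzego (w : UnitDisc) : HardySpace :=
  ((√(1 - ‖(w : ℂ)‖ ^ 2) : ℝ) : ℂ) • szego w

theorem norm_normalizedSzego (w : UnitDisc) : ‖normalizedSzego w‖ = 1 := by
  have h : 0 < 1 - ‖(w : ℂ)‖ ^ 2 := by linarith [w.sq_norm_lt_one]
  rw [← sq_eq_sq₀ (norm_nonneg _) zero_le_one, normalizedSzego, norm_smul, mul_pow, norm_szego_sq,
    Complex.norm_real, Real.norm_of_nonneg (Real.sqrt_nonneg _), Real.sq_sqrt h.le, one_pow,
    mul_inv_cancel₀ h.ne']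

theorem normalizedSzego_mem_modelSpace {s : Set UnitDisc} {w : UnitDisc} (hw : w ∈ s) :
    normalizedSzego w ∈ modelSpace s :=
  Submodule.smul_mem _ _ (szego_mem_modelSpace hw)

theorem inner_normalizedSzego (w : UnitDisc) (f : HardySpace) :
    inner ℂ (normalizedSzego w) f = (√(1 - ‖(w : ℂ)‖ ^ 2) : ℝ) * f.eval w := by
  rw [normalizedSzego, inner_smul_left, inner_szego, Complex.conj_ofReal]

/-- The distance from the normalized kernel at `w` to the model space `K_a` is at least
`|B_a(w)|`. -/
theorem norm_blaschkeProduct_le_norm_sub (a : ℕ → UnitDisc)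
    (haB : Summable fun k => 1 - ‖(a k : ℂ)‖) (w : UnitDisc) {g : HardySpace}
    (hg : g ∈ modelSpace (Set.range a)) :
    ‖blaschkeProduct a w‖ ≤ ‖normalizedSzego w - g‖ := by
  rw [modelSpace_eq_closure_span, ← SetLike.mem_coe, Submodule.topologicalClosure_coe] at hg
  -- The inequality is a closed condition on `g`, so `g` may be taken to be a finite combination of
  -- kernels at the zeros.
  refine closure_minimal (t := {g | ‖blaschkeProduct a w‖ ≤ ‖normalizedSzego w - g‖}) ?_
    (isClosed_le continuous_const (by fun_prop)) hg
  intro g hg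
  -- `F N` is the `N`-th partial Blaschke product times the normalized kernel. It has norm 1 and
  -- vanishes at `a k` once `N > k`, hence is eventually orthogonal to `g`.
  choose F hFn hF using exists_prod_blaschkeFactor_mul a (normalizedSzego w)
  have hzero : ∀ᶠ N in atTop, inner ℂ g (F N) = 0 := by
    simp only [SetLike.mem_coe] at hg
    induction hg using Submodule.span_induction with
    | mem x hx =>
      obtain ⟨_, ⟨k, rfl⟩, rfl⟩ := hx
      filter_upwards [eventually_gt_atTop k] with N hN
      rw [inner_szego, hF, Finset.prod_eq_zero (Finset.mem_range.2 hN) (blaschkeFactor_self _),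
        zero_mul]
    | zero => simp
    | add x y _ _ hx hy =>
      filter_upwards [hx, hy] with N h1 h2
      rw [inner_add_left, h1, h2, add_zero]
    | smul c x _ hx =>
      filter_upwards [hx] with N h1
      rw [inner_smul_left, h1, mul_zero]
  have hself : inner ℂ (normalizedSzego w) (normalizedSzego w) = (1 : ℂ) := by
    rw [inner_self_eq_norm_sq_to_K, norm_normalizedSzego]
    simp
  refine le_of_tendsto (hasProd_blaschkeProduct a haB w).norm.tendsto_prod_nat ?_
  filter_upwards [hzero] with N hN
  have h1 : inner ℂ (normalizedSzego w - g) (F N) =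
      ∏ k ∈ Finset.range N, blaschkeFactor (a k) w := by
    rw [inner_sub_left, hN, sub_zero, inner_normalizedSzego, hF, mul_left_comm,
      ← inner_normalizedSzego, hself, mul_one]
  rw [← norm_prod, ← h1]
  calc _ ≤ ‖normalizedSzego w - g‖ * ‖F N‖ := norm_inner_le_norm _ _
    _ = _ := by rw [hFn, norm_normalizedSzego, mul_one]

end HardySpace

/-! ### Weakly null sequences and compact operators -/

/-- Weak convergence to zero of a bounded family can be tested on a total set. -/
theorem tendsto_inner_zero_of_hasSum {E ι κ : Type*} [NormedAddCommGroup E]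
    [InnerProductSpace ℂ E] {l : Filter ι} {x : ι → E} {C : ℝ} (hx : ∀ i, ‖x i‖ ≤ C)
    {e : κ → E} {v : E} (hv : HasSum e v)
    (h : ∀ k, Tendsto (fun i => inner ℂ (x i) (e k)) l (𝓝 0)) :
    Tendsto (fun i => inner ℂ (x i) v) l (𝓝 0) := by
  rcases isEmpty_or_nonempty ι with hι | ⟨⟨i₀⟩⟩
  · exact (tendsto_of_isEmpty : Tendsto _ l _)
  have hC : 0 ≤ C := (norm_nonneg _).trans (hx i₀)
  rw [Metric.tendsto_nhds]
  intro ε hε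
  -- `C + 1` instead of `C`, since `C` may be 0.
  have hpos : 0 < ε / (2 * (C + 1)) := by positivity
  obtain ⟨s, hs⟩ := (Metric.tendsto_nhds.1 hv _ hpos).exists
  have hsum : Tendsto (fun i => ∑ k ∈ s, inner ℂ (x i) (e k)) l (𝓝 0) := by
    simpa using tendsto_finsetSum s fun k _ => h k
  filter_upwards [Metric.tendsto_nhds.1 hsum _ (half_pos hε)] with i hi
  rw [dist_zero_right, ← inner_sum] at hi
  rw [dist_eq_norm, norm_sub_rev] at hs
  rw [dist_zero_right]
  calc ‖inner ℂ (x i) v‖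
      = ‖inner ℂ (x i) (v - ∑ k ∈ s, e k) + inner ℂ (x i) (∑ k ∈ s, e k)‖ := by
        rw [← inner_add_right, sub_add_cancel]
    _ ≤ ‖x i‖ * ‖v - ∑ k ∈ s, e k‖ + ‖inner ℂ (x i) (∑ k ∈ s, e k)‖ :=
        (norm_add_le _ _).trans (by gcongr; exact norm_inner_le_norm _ _)
    _ ≤ C * (ε / (2 * (C + 1))) + ‖inner ℂ (x i) (∑ k ∈ s, e k)‖ := by
        gcongr
        exact hx i
    _ < C * (ε / (2 * (C + 1))) + ε / 2 := by gcongr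
    _ ≤ ε / 2 + ε / 2 := by
        gcongr
        rw [mul_div_assoc', div_le_div_iff₀ (by positivity) two_pos]
        nlinarith
    _ = ε := by ring

/-- A compact operator pairs a bounded sequence with a weakly null bounded sequence to a null
sequence. -/
theorem IsCompactOperator.tendsto_inner_zero {E : Type*} [NormedAddCommGroup E]
    [InnerProductSpace ℂ E] {T : E →L[ℂ] E} (hT : IsCompactOperator T) {x y : ℕ → E} {C D : ℝ}
    (hx : ∀ n, ‖x n‖ ≤ C) (hy : ∀ n, ‖y n‖ ≤ D)
    (hw : ∀ v, Tendsto (fun n => inner ℂ (x n) v) atTop (𝓝 0)) :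
    Tendsto (fun n => inner ℂ (x n) (T (y n))) atTop (𝓝 0) := by
  obtain ⟨K, hK, hKT⟩ := hT.image_closedBall_subset_compact (𝕜₁ := ℂ) (f := T.toLinearMap) D
  refine tendsto_of_subseq_tendsto fun ns hns => ?_
  obtain ⟨v, -, φ, hφm, hφ⟩ := hK.tendsto_subseq (x := fun n => T (y (ns n))) fun n =>
    hKT ⟨y (ns n), by simpa using hy (ns n), rfl⟩
  refine ⟨φ, ?_⟩
  have h1 : Tendsto (fun n => inner ℂ (x (ns (φ n))) v) atTop (𝓝 0) :=
    (hw v).comp (hns.comp hφm.tendsto_atTop)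
  have h2 : Tendsto (fun n => inner ℂ (x (ns (φ n))) (T (y (ns (φ n))) - v)) atTop (𝓝 0) := by
    refine squeeze_zero_norm (a := fun n => C * ‖T (y (ns (φ n))) - v‖) (fun n => ?_) ?_
    · exact (norm_inner_le_norm _ _).trans (by gcongr; exact hx _)
    · simpa using (tendsto_iff_norm_sub_tendsto_zero.1 hφ).const_mul C
  simpa [inner_sub_right] using h2.add h1

/-! ### Compactness forces `B_a(b j) → 0` -/

namespace HardySpace

/-- Every Taylor coefficient of the normalized kernel at `b j` is at most `√(1 - |b j|²)` in
modulus, so testing on the coordinate vectors suffices. -/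
theorem tendsto_inner_normalizedSzego {b : ℕ → UnitDisc}
    (hb : Tendsto (fun j => ‖(b j : ℂ)‖) atTop (𝓝 1)) (v : HardySpace) :
    Tendsto (fun j => inner ℂ (normalizedSzego (b j)) v) atTop (𝓝 0) := by
  refine tendsto_inner_zero_of_hasSum (fun j => (norm_normalizedSzego (b j)).le)
    (lp.hasSum_single (by norm_num) v) fun n => ?_
  have hs : Tendsto (fun j => √(1 - ‖(b j : ℂ)‖ ^ 2) * ‖v n‖) atTop (𝓝 0) := by
    simpa using (((hb.pow 2).const_sub 1).sqrt).mul_const ‖v n‖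
  refine squeeze_zero_norm (fun j => ?_) hs
  rw [lp.inner_single_right, normalizedSzego, lp.coeFn_smul, Pi.smul_apply, inner_smul_left,
    norm_mul, RCLike.norm_conj, Complex.norm_real, Real.norm_of_nonneg (Real.sqrt_nonneg _)]
  gcongr
  refine (norm_inner_le_norm _ _).trans (mul_le_of_le_one_left (norm_nonneg _) ?_)
  simpa [szego] using pow_le_one₀ (norm_nonneg _) (b j).norm_lt_one.le

/-- Both `x` and its projection to `K_s` lie in `K_{s ∪ t}`, so the difference stays in `H₀`; what
is removed is orthogonal to `Z_s`. -/
theorem zeroSpace₀_starProjection {s t : Set UnitDisc} {x : HardySpace} (hx : x ∈ modelSpace t) :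
    (zeroSpace₀ s t).starProjection x = x - (modelSpace s).starProjection x := by
  have hmem : x - (modelSpace s).starProjection x ∈ zeroSpace₀ s t := by
    refine Submodule.mem_inf.2 ⟨?_, ?_⟩
    · rw [← orthogonal_modelSpace]
      exact Submodule.sub_starProjection_mem_orthogonal _
    · exact Submodule.sub_mem _ (modelSpace_mono Set.subset_union_right hx)
        (modelSpace_mono Set.subset_union_left (Submodule.starProjection_apply_mem _ _))
  refine Submodule.eq_starProjection_of_mem_orthogonal hmem ?_
  rw [sub_sub_cancel]
  exact Submodule.orthogonal_le (inf_le_left : zeroSpace₀ s t ≤ zeroSpace s)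
    (Submodule.starProjection_apply_mem _ _)

theorem tendsto_blaschkeProduct_of_isCompactOperator {a b : ℕ → UnitDisc}
    (haB : Summable fun k => 1 - ‖(a k : ℂ)‖)
    (hb : Tendsto (fun j => ‖(b j : ℂ)‖) atTop (𝓝 1))
    (hT : IsCompactOperator (projProd (Set.range a) (Set.range b))) :
    Tendsto (fun j => blaschkeProduct a (b j)) atTop (𝓝 0) := by
  set x : ℕ → HardySpace := fun j => normalizedSzego (b j) with hxdef
  have hxb : ∀ j, x j ∈ modelSpace (Set.range b) := fun j =>
    normalizedSzego_mem_modelSpace (Set.mem_range_self j)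
  set u : ℕ → HardySpace := fun j => (zeroSpace₀ (Set.range a) (Set.range b)).starProjection (x j)
    with hudef
  have hx1 : ∀ j, ‖x j‖ ≤ 1 := fun j => (norm_normalizedSzego (b j)).le
  have hu1 : ∀ j, ‖u j‖ ≤ 1 := fun j => (Submodule.norm_starProjection_apply_le _ _).trans (hx1 j)
  have hlim := hT.tendsto_inner_zero hx1 hu1 (tendsto_inner_normalizedSzego hb)
  -- Moved to the left of the pairing, `P_{K_b}` fixes `x j` and the other projection turns it into
  -- `u j`.
  have hinner : ∀ j, inner ℂ (x j) (projProd (Set.range a) (Set.range b) (u j)) =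
      ((‖u j‖ ^ 2 : ℝ) : ℂ) := fun j => by
    rw [projProd, ContinuousLinearMap.comp_apply, ← Submodule.inner_starProjection_left_eq_right,
      Submodule.starProjection_eq_self_iff.2 (hxb j),
      ← Submodule.inner_starProjection_left_eq_right]
    change inner ℂ (u j) (u j) = _
    rw [inner_self_eq_norm_sq_to_K]
    push_cast
    rfl
  simp only [hinner] at hlim
  have hu0 : Tendsto (fun j => ‖u j‖) atTop (𝓝 0) := by
    have h := hlim.norm.sqrt
    simpa using h
  refine squeeze_zero_norm (fun j => ?_) hu0
  simp only [hudef]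
  rw [zeroSpace₀_starProjection (hxb j)]
  exact norm_blaschkeProduct_le_norm_sub a haB (b j) (Submodule.starProjection_apply_mem _ _)

end HardySpace

/-! ### Limit sets -/

/-- As `p` is not a value of `u` and finite sets are closed, any initial segment can be cut out of a
neighbourhood of `p`. -/
theorem mapClusterPt_of_mem_closure_range_diff {X : Type*} [TopologicalSpace X] [T1Space X]
    {u : ℕ → X} {p : X} (hp : p ∈ closure (Set.range u) \ Set.range u) :
    MapClusterPt p atTop u := by
  rw [mapClusterPt_iff_frequently]
  intro s hs
  rw [frequently_atTop]
  intro N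
  have hfin : (u '' Set.Iio N).Finite := (Set.finite_Iio N).image u
  have hmem : s ∩ (u '' Set.Iio N)ᶜ ∈ 𝓝 p :=
    inter_mem hs (hfin.isClosed.isOpen_compl.mem_nhds fun ⟨j, _, hj⟩ => hp.2 ⟨j, hj⟩)
  obtain ⟨_, ⟨hs', hn⟩, j, rfl⟩ := mem_closure_iff_nhds.1 hp.1 _ hmem
  exact ⟨j, not_lt.1 fun hj => hn ⟨j, hj, rfl⟩, hs'⟩

theorem limitSet_subset_of_tendsto_blaschkeProduct {a b : ℕ → UnitDisc}
    (haB : Summable fun k => 1 - ‖(a k : ℂ)‖)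
    (hb : Tendsto (fun j => ‖(b j : ℂ)‖) atTop (𝓝 1))
    (hB : Tendsto (fun j => blaschkeProduct a (b j)) atTop (𝓝 0)) :
    limitSet (Set.range b) ⊆ limitSet (Set.range a) := by
  intro p hp
  simp only [limitSet, ← Set.range_comp'] at hp ⊢
  have hcl := mapClusterPt_of_mem_closure_range_diff hp
  have hp1 : ‖p‖ = 1 := by
    have h : ClusterPt ‖p‖ (𝓝 1) :=
      (hcl.tendsto_comp (continuous_norm.tendsto p)).clusterPt.mono hb
    exact eq_of_nhds_neBot h
  refine ⟨?_, ?_⟩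
  · by_contra hpa
    obtain ⟨d, hd, hball⟩ := Metric.mem_nhds_iff.1 (isClosed_closure.isOpen_compl.mem_nhds hpa)
    have hda : ∀ k, d ≤ ‖(a k : ℂ) - p‖ := fun k => by
      by_contra! hlt
      exact hball (mem_ball_iff_norm.2 hlt) (subset_closure ⟨k, rfl⟩)
    set C := 2 / (d / 2) ^ 2 * ∑' k, (1 - ‖(a k : ℂ)‖)
    have h1 : Tendsto (fun j => 1 - (1 - ‖(b j : ℂ)‖ ^ 2) * C) atTop (𝓝 1) := by
      simpa using ((((hb.pow 2).const_sub 1).mul_const C).const_sub 1)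
    have h2 : Tendsto (fun j => ‖blaschkeProduct a (b j)‖ ^ 2) atTop (𝓝 0) := by
      simpa using hB.norm.pow 2
    -- Some `b j` within `d / 2` of `p` has `|B_a(b j)|²` below the bound of
    -- `le_norm_blaschkeProduct_sq`. The contradiction needs `|1 - conj (a k) * b j| ≥ d / 2`: at
    -- `p` this modulus is `|a k - p| ≥ d` because `|p| = 1`, and passing to `b j` costs at most `d
    -- / 2`.
    obtain ⟨j, hj, hlt⟩ := ((hcl.frequently (Metric.ball_mem_nhds p (half_pos hd))).and_eventually
      (h2.eventually_lt h1 zero_lt_one)).exists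
    refine hlt.not_ge (le_norm_blaschkeProduct_sq a haB (b j) (half_pos hd) fun k => ?_)
    have hnorm : ‖1 - starRingEnd ℂ (a k : ℂ) * p‖ = ‖(a k : ℂ) - p‖ := by
      rw [← sq_eq_sq₀ (norm_nonneg _) (norm_nonneg _), norm_one_sub_conj_mul_sq, hp1]
      ring
    have hclose : ‖starRingEnd ℂ (a k : ℂ) * ((b j : ℂ) - p)‖ ≤ d / 2 := by
      rw [norm_mul, RCLike.norm_conj]
      have := mem_ball_iff_norm.1 hj
      nlinarith [(a k).norm_lt_one, norm_nonneg ((b j : ℂ) - p), norm_nonneg (a k : ℂ)]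
    have hdec : 1 - starRingEnd ℂ (a k : ℂ) * p = (1 - starRingEnd ℂ (a k : ℂ) * b j) +
        starRingEnd ℂ (a k : ℂ) * ((b j : ℂ) - p) := by ring
    have := norm_add_le (1 - starRingEnd ℂ (a k : ℂ) * b j)
      (starRingEnd ℂ (a k : ℂ) * ((b j : ℂ) - p))
    rw [← hdec, hnorm] at this
    linarith [hda k]
  · rintro ⟨k, rfl⟩
    exact (a k).norm_ne_one hp1

theorem tendsto_norm_of_summable_one_sub_norm {b : ℕ → UnitDisc}
    (hbB : Summable fun j => 1 - ‖(b j : ℂ)‖) :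
    Tendsto (fun j => ‖(b j : ℂ)‖) atTop (𝓝 1) := by
  simpa using hbB.tendsto_atTop_zero.const_sub 1

theorem proposition5p7 (a b : ℕ → UnitDisc)
    (ha : Function.Injective a) (hb : Function.Injective b)
    (hab : Disjoint (Set.range a) (Set.range b))
    (haB : Summable fun k => 1 - ‖(a k : ℂ)‖)
    (hbB : Summable fun j => 1 - ‖(b j : ℂ)‖) :
    (IsCompactOperator (HardySpace.projProd (Set.range a) (Set.range b)) →
      Tendsto (fun j => blaschkeProduct a (b j)) atTop (𝓝 0) ∧
        limitSet (Set.range b) ⊆ limitSet (Set.range a)) ∧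
    (IsCompactOperator (HardySpace.projProd (Set.range a) (Set.range b)) →
      IsCompactOperator (HardySpace.projProd (Set.range b) (Set.range a)) →
        limitSet (Set.range a) = limitSet (Set.range b)) := by
  have hb1 := tendsto_norm_of_summable_one_sub_norm hbB
  have ha1 := tendsto_norm_of_summable_one_sub_norm haB
  have hab0 := HardySpace.tendsto_blaschkeProduct_of_isCompactOperator haB hb1
  have hba0 := HardySpace.tendsto_blaschkeProduct_of_isCompactOperator hbB ha1
  exact ⟨fun h => ⟨hab0 h, limitSet_subset_of_tendsto_blaschkeProduct haB hb1 (hab0 h)⟩,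
    fun h h' => (limitSet_subset_of_tendsto_blaschkeProduct hbB ha1 (hba0 h')).antisymm
      (limitSet_subset_of_tendsto_blaschkeProduct haB hb1 (hab0 h))⟩
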